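/- Let $(a_i)_{i\in\mathbb Z}$ be positive integers, and let $\Delta,\widetilde\Delta$ be the real numbers with infinite regular continued fraction expansions $\Delta=[a_0,a_1,a_2,\dots]$ and $-\widetilde\Delta=[0,a_{-1},a_{-2},\dots]$ (so $\Delta>1$ and $-1<\widetilde\Delta<0$ are irrational). Let $\Lambda\subset\mathbb R^2$ be the lattice generated by $(1,1)$ and $(-\Delta,-\widetilde\Delta)$; suppose it is irrational, i.e. no two distinct points of it lie on a common horizontal or vertical line (this is in fact automatic). Let $\det(\Lambda)$ be the absolute value of the determinant of the matrix with these two columns. An empty box is an open axis-parallel box containing no point of $\Lambda$; it is maximal if it is not properly contained in another empty box. The dispersion of $\Lambda$ is the supremum in $[0,\infty]$ of the areas of all empty boxes. Let $\mathcal B$ be the set of maximal empty boxes whose bottom side contains the origin in its relative interior. Then $\mathcal B$ can be indexed in exactly one way as $\{B_n:n\in\mathbb Z\}$ with strictly increasing heights and $B_0=(-\Delta,1)\times(0,1-\widetilde\Delta)$. Put $A_i=\sum_{k=0}^{i-1}a_k$ for $i\ge 0$ and $A_i=-\sum_{k=i}^{-1}a_k$ for $i<0$, and for a positive integer $a$ put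 $$L(a)=\frac a4+1+\frac1a-\frac{r}{4a},\qquad r\in\{0,1\},\ r\equiv a \pmod 2.$$ For every $i\in\mathbb Z$ with $a_i>1$, $$L(a_i)<\max_{0\le j<a_i}\frac{\operatorname{vol}(B_{A_i+j})}{\det(\Lambda)}<L(a_i+2)<L(a_i)+\frac12 .$$ Moreover, $\Lambda$ has finite dispersion if and only if the sequence $(a_i)_{i\in\mathbb Z}$ is bounded. -/

import Mathlib

open MeasureTheory

noncomputable section

/-- A nondegenerate open axis-parallel box `(left, right) × (bottom, top)` in the plane. -/
structure AxisBox where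
  left : ℝ
  right : ℝ
  bottom : ℝ
  top : ℝ
  left_lt_right : left < right
  bottom_lt_top : bottom < top

/-- The open box as a subset of the plane. -/
def AxisBox.toSet (b : AxisBox) : Set (ℝ × ℝ) :=
  Set.Ioo b.left b.right ×ˢ Set.Ioo b.bottom b.top

/-- The area of a box. -/
def AxisBox.area (b : AxisBox) : ℝ := (volume b.toSet).toReal

/-- The vertical extent of a box. -/
def AxisBox.height (b : AxisBox) : ℝ := b.top - b.bottom

/-- The subgroup of the plane generated by the two columns of `M`. -/
def latticeOf (M : Matrix (Fin 2) (Fin 2) ℝ) : AddSubgroup (ℝ × ℝ) :=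
  AddSubgroup.closure {(M 0 0, M 1 0), (M 0 1, M 1 1)}

/-- No two distinct points lie on a common vertical or horizontal line. -/
def IsIrrationalLattice (Γ : AddSubgroup (ℝ × ℝ)) : Prop :=
  ∀ u ∈ Γ, ∀ v ∈ Γ, u ≠ v → u.1 ≠ v.1 ∧ u.2 ≠ v.2

/-- The open box contains no point of `Γ`. -/
def IsEmptyBox (Γ : AddSubgroup (ℝ × ℝ)) (b : AxisBox) : Prop :=
  Disjoint b.toSet (Γ : Set (ℝ × ℝ))

/-- An empty box that is not properly contained in another empty box. -/
def IsMaximalEmptyBox (Γ : AddSubgroup (ℝ × ℝ)) (b : AxisBox) : Prop :=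
  IsEmptyBox Γ b ∧ ∀ b' : AxisBox, IsEmptyBox Γ b' → b.toSet ⊆ b'.toSet → b'.toSet ⊆ b.toSet

/-- The dispersion of `Γ`: the supremum of the areas of all empty boxes, possibly infinite. -/
def latticeDispersion (Γ : AddSubgroup (ℝ × ℝ)) : ENNReal :=
  ⨆ (b : AxisBox) (_ : IsEmptyBox Γ b), volume b.toSet

/-- The maximal empty boxes whose bottom side contains the origin in its relative interior. -/
def originBoxes (Γ : AddSubgroup (ℝ × ℝ)) : Set AxisBox :=
  {b | IsMaximalEmptyBox Γ b ∧ b.bottom = 0 ∧ b.left < 0 ∧ 0 < b.right}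

/-- The generating matrix with columns `(1, 1)` and `(-Δ, -Δ')`. -/
def normalizedMatrix (Δ Δ' : ℝ) : Matrix (Fin 2) (Fin 2) ℝ := !![1, -Δ; 1, -Δ']

/-- `B` lists all maximal empty boxes bounded by the origin on the bottom, ordered by height, and
indexed so that `B 0 = (-Δ, 1) × (0, 1 - Δ')`. -/
structure IsBoxEnumeration (Δ Δ' : ℝ) (B : ℤ → AxisBox) : Prop where
  strictMono_height : StrictMono fun n => (B n).height
  range_eq : Set.range B = originBoxes (latticeOf (normalizedMatrix Δ Δ'))
  toSet_zero : (B 0).toSet = Set.Ioo (-Δ) 1 ×ˢ Set.Ioo 0 (1 - Δ')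

/-- The regular continued fraction expansion of `x` is infinite and equals `[c 0, c 1, c 2, …]`. -/
def HasContFracExpansion (x : ℝ) (c : ℕ → ℕ) : Prop :=
  (GenContFract.of x).h = (c 0 : ℝ) ∧
    ∀ n : ℕ, (GenContFract.of x).partDens.get? n = some (c (n + 1) : ℝ)

/-- `A_i = a_0 + ⋯ + a_{i-1}` for `i ≥ 0`, and `A_i = -(a_i + ⋯ + a_{-1})` for `i < 0`. -/
def partialSum (a : ℤ → ℕ) (i : ℤ) : ℤ :=
  if 0 ≤ i then ∑ k ∈ Finset.Ico 0 i, (a k : ℤ) else -∑ k ∈ Finset.Ico i 0, (a k : ℤ)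

/-- `L(a) = a/4 + 1 + 1/a - r/(4a)`, where `r ∈ {0, 1}` is the parity of `a`. -/
def boundL (a : ℕ) : ℝ :=
  (a : ℝ) / 4 + 1 + 1 / (a : ℝ) - ((a % 2 : ℕ) : ℝ) / (4 * (a : ℝ))

end

noncomputable section

/-! ### Real numbers with a prescribed continued fraction -/

/-! Run the Euclidean algorithm on `Δ : 1` forwards and on `-Δ' : 1` backwards. This gives positive
two-sided sequences with `X (i-1) = a i * X i + X (i+1)` and `Y (i+1) = a i * Y i + Y (i-1)`
(`exists_isLadder`). The vectors v_i = ((-1)^i X_i, Y_i) then satisfy v_{i+1} = v_{i-1} + a_i v_i,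
so for 0 ≤ j ≤ a_i the pair v_i, v_{i-1} + j v_i is a lattice basis lying in the two open upper
quadrants.

A basis p, q of this kind spans a box with 0, p, q, p + q on its four sides, and that box is empty
and maximal. The heights of these boxes increase with the index, from near 0 to infinity, and no
other origin box fits between consecutive ones, so they are exactly the enumeration
(`IsLadderBoxes.range_eq`).

With θ = X_{i+1}/X_i and δ = Y_{i-1}/Y_i, both in (0, 1), the normalized area is (1+x)(1+y)/(x+y)
for x = a_i + θ - j, y = δ + j. It increases in each variable once the other exceeds 1. Comparison
with θ = δ = 0 at the middle j, and with θ = δ = 1 for j ≥ 1, gives the bounds L(a_i) and L(a_i +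
2).

Since a/4 ≤ L(a), finite dispersion bounds `a`. Conversely, an empty box higher than a spanned box
is no wider than it (`IsUpperBasis.width_le_of_isEmptyBox`), which bounds all areas when `a` is
bounded. -/

theorem HasContFracExpansion.step {x : ℝ} {c : ℕ → ℕ} (h : HasContFracExpansion x c) :
    ⌊x⌋ = (c 0 : ℤ) ∧ 0 < Int.fract x ∧
      HasContFracExpansion (Int.fract x)⁻¹ (fun n => c (n + 1)) := by
  obtain ⟨h0, h1⟩ := h
  have hfl : ⌊x⌋ = (c 0 : ℤ) := by
    rw [GenContFract.of_h_eq_floor] at h0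
    exact_mod_cast h0
  have hfr : Int.fract x ≠ 0 := by
    intro hz
    have hx : x = ((⌊x⌋ : ℤ) : ℝ) := by
      have := Int.floor_add_fract x
      rw [hz] at this; linarith
    have := h1 0
    rw [GenContFract.partDens, Stream'.Seq.map_get?, hx, GenContFract.of_s_of_int] at this
    simp at this
  refine ⟨hfl, lt_of_le_of_ne (Int.fract_nonneg x) hfr.symm, ?_, ?_⟩
  · have := h1 0
    rw [GenContFract.partDens, Stream'.Seq.map_get?] at this
    have hh := GenContFract.of_s_head hfr
    rw [Stream'.Seq.head] at hh
    rw [hh] at this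
    simp only [Option.map_some, Option.some.injEq, zero_add] at this
    rw [GenContFract.of_h_eq_floor]
    simpa using this
  · intro n
    have := h1 (n + 1)
    rw [GenContFract.partDens, Stream'.Seq.map_get?, GenContFract.of_s_succ] at this
    rw [GenContFract.partDens, Stream'.Seq.map_get?]
    exact this

/-- The remainders of the Euclidean algorithm for `x : 1` are positive. -/
theorem HasContFracExpansion.remainder_pos {x : ℝ} {c : ℕ → ℕ} (h : HasContFracExpansion x c)
    {Z : ℕ → ℝ} (h0 : Z 0 = x * Z 1) (h1 : 0 < Z 1)
    (hZ : ∀ n, Z n = c n * Z (n + 1) + Z (n + 2)) (n : ℕ) : 0 < Z (n + 1) := by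
  induction n generalizing x c Z with
  | zero => exact h1
  | succ n ih =>
    obtain ⟨hfl, hfr, hs⟩ := h.step
    have hx : x = c 0 + Int.fract x := by
      have := Int.floor_add_fract x
      rw [hfl] at this
      exact_mod_cast this.symm
    have h2 : Z 2 = Int.fract x * Z 1 := by
      have := hZ 0
      simp only [zero_add] at this
      rw [h0] at this
      linear_combination -this + Z 1 * hx
    refine ih hs (Z := fun n => Z (n + 1)) ?_ ?_ (fun n => hZ (n + 1))
    · simp only [zero_add]
      change Z 1 = (Int.fract x)⁻¹ * Z 2
      rw [h2]
      field_simp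
    · change 0 < Z 2
      rw [h2]
      positivity

/-! ### Sequences indexed by the integers -/

theorem exists_int_orbit {α : Type*} (f : ℤ → α ≃ α) (x : α) :
    ∃ g : ℤ → α, g 0 = x ∧ ∀ i, g (i + 1) = f i (g i) := by
  refine ⟨fun i => Int.rec (motive := fun _ => α) (fun n => Nat.rec x (fun k y => f k y) n)
    (fun n => Nat.rec ((f (-1)).symm x) (fun k y => (f (Int.negSucc (k + 1))).symm y) n) i,
    rfl, ?_⟩
  intro i
  rcases i with n | n
  · rfl
  · cases n with
    | zero => exact ((f (-1)).apply_symm_apply x).symm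
    | succ n => exact ((f (Int.negSucc (n + 1))).apply_symm_apply _).symm

/-- Solutions of a two-sided three-term recurrence. -/
theorem exists_recurrence (c : ℤ → ℝ) (x y : ℝ) :
    ∃ Z : ℤ → ℝ, Z (-1) = x ∧ Z 0 = y ∧ ∀ i, Z (i + 1) = Z (i - 1) + c i * Z i := by
  let f : ℤ → (ℝ × ℝ ≃ ℝ × ℝ) := fun i =>
    { toFun := fun p => (p.2, p.1 + c i * p.2)
      invFun := fun p => (p.2 - c i * p.1, p.1)
      left_inv := fun p => by ext <;> simp
      right_inv := fun p => by ext <;> simp }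
  obtain ⟨g, g0, hg⟩ := exists_int_orbit f (x, y)
  have h1 : ∀ i, (g (i + 1)).1 = (g i).2 := fun i => by rw [hg]; rfl
  refine ⟨fun i => (g i).2, ?_, by simp [g0], fun i => ?_⟩
  · have := h1 (-1)
    simp [g0] at this
    exact this.symm
  · have := h1 (i - 1)
    rw [sub_add_cancel] at this
    change (g (i + 1)).2 = (g (i - 1)).2 + c i * (g i).2
    rw [← this, hg]
    rfl

theorem exists_int_lt_le_succ {α : Type*} [LinearOrder α] {f : ℤ → α} (hf : StrictMono f) {t : α}
    (hlo : ∃ i, f i < t) (hhi : ∃ i, t ≤ f i) : ∃ i, f i < t ∧ t ≤ f (i + 1) := by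
  obtain ⟨u, hu⟩ := hhi
  obtain ⟨i, hi, hmax⟩ := Int.exists_greatest_of_bdd (P := fun i => f i < t)
    ⟨u, fun z hz => (hf.lt_iff_lt.1 (hz.trans_le hu)).le⟩ hlo
  refine ⟨i, hi, not_lt.1 fun h => ?_⟩
  have := hmax _ h
  omega

theorem StrictMono.eq_id_of_surjective {φ : ℤ → ℤ} (hφ : StrictMono φ)
    (hs : Function.Surjective φ) (h0 : φ 0 = 0) (n : ℤ) : φ n = n := by
  have hsucc : ∀ n, φ (n + 1) = φ n + 1 := by
    intro n
    obtain ⟨m, hm⟩ := hs (φ n + 1)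
    have h1 : n < m := hφ.lt_iff_lt.1 (by omega)
    have h2 : φ (n + 1) ≤ φ m := hφ.monotone (by omega)
    have h3 : φ n < φ (n + 1) := hφ (by omega)
    omega
  induction n using Int.induction_on with
  | zero => exact h0
  | succ n ih => rw [hsucc, ih]
  | pred n ih =>
    have := hsucc (-n - 1)
    rw [sub_add_cancel] at this
    omega

/-! ### Partial sums -/

theorem partialSum_zero (a : ℤ → ℕ) : partialSum a 0 = 0 := by simp [partialSum]

theorem partialSum_add_one (a : ℤ → ℕ) (i : ℤ) :
    partialSum a (i + 1) = partialSum a i + a i := by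
  unfold partialSum
  rcases lt_trichotomy i (-1) with h | rfl | h
  · rw [if_neg (by omega), if_neg (by omega),
      ← Finset.insert_Ico_add_one_left_eq_Ico (a := i) (b := 0) (by omega),
      Finset.sum_insert (by simp)]
    ring
  · simp only [Int.reduceNeg, neg_add_cancel, le_refl, if_true, Finset.Ico_self,
      Finset.sum_empty]
    rw [if_neg (by omega), show Finset.Ico (-1 : ℤ) 0 = {-1} from rfl]
    simp
  · rw [if_pos (by omega), if_pos (by omega),
      ← Finset.insert_Ico_right_eq_Ico_add_one (a := 0) (b := i) (by omega),
      Finset.sum_insert (by simp)]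
    ring

theorem partialSum_strictMono {a : ℤ → ℕ} (ha : ∀ i, 0 < a i) : StrictMono (partialSum a) :=
  strictMono_int_of_lt_succ fun i => by
    rw [partialSum_add_one]
    have := ha i
    omega

theorem exists_partialSum_add {a : ℤ → ℕ} (ha : ∀ i, 0 < a i) (n : ℤ) :
    ∃ i : ℤ, ∃ j : ℕ, j < a i ∧ n = partialSum a i + j := by
  have hm := partialSum_strictMono ha
  have hup : ∀ k : ℕ, (k : ℤ) ≤ partialSum a k := by
    intro k
    induction k with
    | zero => simp [partialSum_zero]
    | succ k ih =>
      have := hm (show (k : ℤ) < (k + 1 : ℕ) by push_cast; omega)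
      push_cast at *
      omega
  have hdn : ∀ k : ℕ, partialSum a (-k) ≤ -k := by
    intro k
    induction k with
    | zero => simp [partialSum_zero]
    | succ k ih =>
      have := hm (show (-(k + 1 : ℕ) : ℤ) < -k by push_cast; omega)
      push_cast at *
      omega
  -- The threshold n + 1 turns the half-open bracket into A_i ≤ n < A_{i+1}.
  obtain ⟨i, h1, h2⟩ := exists_int_lt_le_succ hm (t := n + 1)
    ⟨-(n.natAbs : ℤ), by have := hdn n.natAbs; omega⟩
    ⟨((n.natAbs + 1 : ℕ) : ℤ), by have := hup (n.natAbs + 1); omega⟩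
  rw [partialSum_add_one] at h2
  exact ⟨i, (n - partialSum a i).toNat, by omega, by omega⟩

/-! ### Boxes -/

theorem AxisBox.toSet_subset_iff {b c : AxisBox} :
    b.toSet ⊆ c.toSet ↔
      (c.left ≤ b.left ∧ b.right ≤ c.right) ∧ c.bottom ≤ b.bottom ∧ b.top ≤ c.top := by
  have hb : b.toSet.Nonempty :=
    (Set.nonempty_Ioo.2 b.left_lt_right).prod (Set.nonempty_Ioo.2 b.bottom_lt_top)
  constructor
  · intro h
    have h' : Set.Ioo b.left b.right ⊆ Set.Ioo c.left c.right ∧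
        Set.Ioo b.bottom b.top ⊆ Set.Ioo c.bottom c.top := by
      rcases Set.prod_subset_prod_iff.1 h with h' | h' | h'
      · exact h'
      · exact absurd h' (Set.nonempty_Ioo.2 b.left_lt_right).ne_empty
      · exact absurd h' (Set.nonempty_Ioo.2 b.bottom_lt_top).ne_empty
    exact ⟨(Set.Ioo_subset_Ioo_iff b.left_lt_right).1 h'.1,
      (Set.Ioo_subset_Ioo_iff b.bottom_lt_top).1 h'.2⟩
  · rintro ⟨⟨h1, h2⟩, h3, h4⟩
    exact Set.prod_mono (Set.Ioo_subset_Ioo h1 h2) (Set.Ioo_subset_Ioo h3 h4)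

theorem AxisBox.toSet_injective : Function.Injective AxisBox.toSet := by
  intro b c h
  obtain ⟨⟨h1, h2⟩, h3, h4⟩ := AxisBox.toSet_subset_iff.1 h.subset
  obtain ⟨⟨h1', h2'⟩, h3', h4'⟩ := AxisBox.toSet_subset_iff.1 h.symm.subset
  cases b; cases c
  simp only [AxisBox.mk.injEq]
  exact ⟨le_antisymm h1' h1, le_antisymm h2 h2', le_antisymm h3' h3, le_antisymm h4 h4'⟩

theorem AxisBox.volume_toSet (b : AxisBox) :
    volume b.toSet = ENNReal.ofReal ((b.right - b.left) * b.height) := by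
  rw [AxisBox.toSet, Measure.volume_eq_prod, Measure.prod_prod, Real.volume_Ioo, Real.volume_Ioo,
    ← ENNReal.ofReal_mul (sub_nonneg.2 b.left_lt_right.le), AxisBox.height]

theorem AxisBox.area_eq (b : AxisBox) : b.area = (b.right - b.left) * b.height := by
  rw [AxisBox.area, AxisBox.volume_toSet, ENNReal.toReal_ofReal]
  exact mul_nonneg (sub_nonneg.2 b.left_lt_right.le) (sub_nonneg.2 b.bottom_lt_top.le)

theorem IsEmptyBox.notMem {Γ : AddSubgroup (ℝ × ℝ)} {b : AxisBox} (h : IsEmptyBox Γ b)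
    {z : ℝ × ℝ} (hz : z ∈ Γ) (h1 : b.left < z.1) (h2 : z.1 < b.right) (h3 : b.bottom < z.2)
    (h4 : z.2 < b.top) : False :=
  Set.disjoint_left.1 h ⟨⟨h1, h2⟩, h3, h4⟩ hz

/-- A basis of `Γ` whose members lie in the two different open upper quadrants. -/
structure IsUpperBasis (Γ : AddSubgroup (ℝ × ℝ)) (p q : ℝ × ℝ) : Prop where
  closure_eq : AddSubgroup.closure {p, q} = Γ
  fst_mul_neg : p.1 * q.1 < 0
  snd_left_pos : 0 < p.2
  snd_right_pos : 0 < q.2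

/-- The box through the origin, `p`, `q` and `p + q`. -/
structure IsSpannedBy (b : AxisBox) (p q : ℝ × ℝ) : Prop where
  left_eq : b.left = min p.1 q.1
  right_eq : b.right = max p.1 q.1
  bottom_eq : b.bottom = 0
  top_eq : b.top = p.2 + q.2

theorem IsUpperBasis.symm {Γ : AddSubgroup (ℝ × ℝ)} {p q : ℝ × ℝ} (h : IsUpperBasis Γ p q) :
    IsUpperBasis Γ q p :=
  ⟨by rw [Set.pair_comm, h.closure_eq], by rw [mul_comm]; exact h.fst_mul_neg,
    h.snd_right_pos, h.snd_left_pos⟩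

theorem IsSpannedBy.symm {b : AxisBox} {p q : ℝ × ℝ} (h : IsSpannedBy b p q) :
    IsSpannedBy b q p :=
  ⟨by rw [min_comm, h.left_eq], by rw [max_comm, h.right_eq], h.bottom_eq,
    by rw [add_comm, h.top_eq]⟩

theorem IsSpannedBy.unique {b c : AxisBox} {p q : ℝ × ℝ} (hb : IsSpannedBy b p q)
    (hc : IsSpannedBy c p q) : b = c := by
  obtain ⟨h1, h2, h3, h4⟩ := hb
  obtain ⟨h1', h2', h3', h4'⟩ := hc
  cases b; cases c
  simp_all

theorem IsSpannedBy.height_eq {b : AxisBox} {p q : ℝ × ℝ} (h : IsSpannedBy b p q) :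
    b.height = p.2 + q.2 := by
  rw [AxisBox.height, h.top_eq, h.bottom_eq, sub_zero]

theorem IsSpannedBy.width_eq {b : AxisBox} {p q : ℝ × ℝ} (h : IsSpannedBy b p q) :
    b.right - b.left = |p.1 - q.1| := by
  rw [h.right_eq, h.left_eq, max_sub_min_eq_abs']

namespace IsUpperBasis

variable {Γ : AddSubgroup (ℝ × ℝ)} {p q : ℝ × ℝ}

theorem exists_isSpannedBy (h : IsUpperBasis Γ p q) : ∃ b, IsSpannedBy b p q := by
  refine ⟨⟨min p.1 q.1, max p.1 q.1, 0, p.2 + q.2, ?_, add_pos h.snd_left_pos h.snd_right_pos⟩,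
    rfl, rfl, rfl, rfl⟩
  rw [min_lt_max]
  intro he
  have := h.fst_mul_neg
  rw [he] at this
  nlinarith [mul_self_nonneg q.1]

theorem left_mem (h : IsUpperBasis Γ p q) : p ∈ Γ := by
  rw [← h.closure_eq]
  exact AddSubgroup.subset_closure (by simp)

theorem exists_coords (h : IsUpperBasis Γ p q) {z : ℝ × ℝ} (hz : z ∈ Γ) :
    ∃ m n : ℤ, z.1 = m * p.1 + n * q.1 ∧ z.2 = m * p.2 + n * q.2 := by
  rw [← h.closure_eq, AddSubgroup.mem_closure_pair] at hz
  obtain ⟨m, n, rfl⟩ := hz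
  exact ⟨m, n, by simp, by simp⟩

theorem coords_mem (h : IsUpperBasis Γ p q) (m n : ℤ) :
    ((m * p.1 + n * q.1, m * p.2 + n * q.2) : ℝ × ℝ) ∈ Γ := by
  rw [← h.closure_eq, AddSubgroup.mem_closure_pair]
  exact ⟨m, n, by ext <;> simp⟩

/-- By symmetry it suffices to treat bases whose first vector points to the right. -/
theorem wlog_pos {P : ℝ × ℝ → ℝ × ℝ → Prop} (h : IsUpperBasis Γ p q)
    (hsymm : ∀ {p q}, P p q → P q p)
    (hP : ∀ {p q}, IsUpperBasis Γ p q → 0 < p.1 → q.1 < 0 → P p q) : P p q := by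
  rcases mul_neg_iff.1 h.fst_mul_neg with ⟨h1, h2⟩ | ⟨h1, h2⟩
  · exact hP h h1 h2
  · exact hsymm (hP h.symm h2 h1)

/-- For a point m p + n q, the vertical bounds rule out m, n ≥ 1 and m, n ≤ 0. In the mixed cases
the opposite signs of the abscissas push the point past the left or right side. -/
theorem isEmptyBox (h : IsUpperBasis Γ p q) {b : AxisBox} (hb : IsSpannedBy b p q) :
    IsEmptyBox Γ b := by
  revert hb
  refine h.wlog_pos (P := fun p q => IsSpannedBy b p q → IsEmptyBox Γ b)
    (fun H hb => H hb.symm) ?_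
  intro p q h h1 h2 hb
  obtain ⟨hl, hr, hbo, ht⟩ := hb
  rw [min_eq_right (by linarith)] at hl
  rw [max_eq_left (by linarith)] at hr
  refine Set.disjoint_left.2 ?_
  rintro z ⟨⟨hz1, hz2⟩, hz3, hz4⟩ hz
  obtain ⟨m, n, e1, e2⟩ := h.exists_coords hz
  rw [hl, e1] at hz1
  rw [hr, e1] at hz2
  rw [hbo, e2] at hz3
  rw [ht, e2] at hz4
  have hp := h.snd_left_pos
  have hq := h.snd_right_pos
  rcases le_or_gt m 0 with hm | hm <;> rcases le_or_gt n 0 with hn | hn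
  · have hm' : (m : ℝ) ≤ 0 := by exact_mod_cast hm
    have hn' : (n : ℝ) ≤ 0 := by exact_mod_cast hn
    nlinarith
  · have hm' : (m : ℝ) ≤ 0 := by exact_mod_cast hm
    have hn' : (1 : ℝ) ≤ n := by exact_mod_cast hn
    nlinarith
  · have hm' : (1 : ℝ) ≤ m := by exact_mod_cast hm
    have hn' : (n : ℝ) ≤ 0 := by exact_mod_cast hn
    nlinarith
  · have hm' : (1 : ℝ) ≤ m := by exact_mod_cast hm
    have hn' : (1 : ℝ) ≤ n := by exact_mod_cast hn
    nlinarith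

/-- Each side carries one of 0, p, q, p + q in its relative interior, so no side can be moved
outwards. -/
theorem mem_originBoxes (h : IsUpperBasis Γ p q) {b : AxisBox} (hb : IsSpannedBy b p q) :
    b ∈ originBoxes Γ := by
  have hempty := h.isEmptyBox hb
  revert hb
  refine h.wlog_pos (P := fun p q => IsSpannedBy b p q → b ∈ originBoxes Γ)
    (fun H hb => H hb.symm) ?_
  intro p q h h1 h2 hb
  obtain ⟨hl, hr, hbo, ht⟩ := hb
  rw [min_eq_right (by linarith)] at hl
  rw [max_eq_left (by linarith)] at hr
  have hp := h.snd_left_pos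
  have hq := h.snd_right_pos
  refine ⟨⟨hempty, ?_⟩, hbo, by linarith, by linarith⟩
  intro c hc hbc
  obtain ⟨⟨c1, c2⟩, c3, c4⟩ := AxisBox.toSet_subset_iff.1 hbc
  refine AxisBox.toSet_subset_iff.2 ⟨⟨?_, ?_⟩, ?_, ?_⟩ <;> by_contra! hlt
  · exact hc.notMem h.symm.left_mem (by linarith) (by linarith) (by linarith) (by linarith)
  · exact hc.notMem h.left_mem (by linarith) (by linarith) (by linarith) (by linarith)
  · exact hc.notMem Γ.zero_mem (by simp; linarith) (by simp; linarith) (by simp; linarith)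
      (by simp; linarith)
  · exact hc.notMem (Γ.add_mem h.left_mem h.symm.left_mem) (by simp; linarith)
      (by simp; linarith) (by simp; linarith) (by simp; linarith)

/-- An origin box that is higher than `p` and `q` but not than `p + q` is spanned by them. -/
theorem eq_of_mem_originBoxes (h : IsUpperBasis Γ p q) {b c : AxisBox} (hb : IsSpannedBy b p q)
    (hc : c ∈ originBoxes Γ) (hp : p.2 < c.height) (hq : q.2 < c.height)
    (hpq : c.height ≤ p.2 + q.2) : c = b := by
  obtain ⟨⟨hce, hmax⟩, hc0, hcl, hcr⟩ := hc
  rw [AxisBox.height, hc0, sub_zero] at hp hq hpq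
  have hsub : c.toSet ⊆ b.toSet := by
    have hbemp := h.isEmptyBox hb
    revert hb hp hq hpq
    refine h.wlog_pos (P := fun p q => IsSpannedBy b p q → p.2 < c.top → q.2 < c.top →
      c.top ≤ p.2 + q.2 → c.toSet ⊆ b.toSet)
      (fun H hb hp hq hpq => H hb.symm hq hp (by linarith)) ?_
    intro p q h h1 h2 hb hp hq hpq
    obtain ⟨hl, hr, hbo, ht⟩ := hb
    rw [min_eq_right (by linarith)] at hl
    rw [max_eq_left (by linarith)] at hr
    have hp' := h.snd_left_pos
    have hq' := h.snd_right_pos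
    refine AxisBox.toSet_subset_iff.2 ⟨⟨?_, ?_⟩, by linarith, by linarith⟩ <;> by_contra! hlt
    · exact hce.notMem h.symm.left_mem (by linarith) (by linarith) (by linarith) (by linarith)
    · exact hce.notMem h.left_mem (by linarith) (by linarith) (by linarith) (by linarith)
  exact AxisBox.toSet_injective (hsub.antisymm (hmax b (h.isEmptyBox hb) hsub))

/-- A box exceeding both extents of the fundamental parallelogram contains a lattice point. -/
theorem width_le_of_isEmptyBox (h : IsUpperBasis Γ p q) {b : AxisBox} (hb : IsEmptyBox Γ b)
    (hh : p.2 + q.2 < b.height) : b.right - b.left ≤ |p.1 - q.1| := by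
  revert hh
  refine h.wlog_pos (P := fun p q => p.2 + q.2 < b.height → b.right - b.left ≤ |p.1 - q.1|)
    (fun H hh => by rw [abs_sub_comm]; exact H (by linarith)) ?_
  intro p q h h1 h2 hh
  by_contra! hw
  rw [abs_of_pos (by linarith)] at hw
  rw [AxisBox.height] at hh
  have hp := h.snd_left_pos
  have hq := h.snd_right_pos
  -- Rounding s, t up adds a vector with abscissa in (q.1, p.1) and ordinate in [0, p.2 + q.2). The
  -- base point is chosen so that all such sums stay inside the box, with half of the excess width
  -- and height as margin.
  obtain ⟨s, t, e1, e2⟩ : ∃ s t : ℝ,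
      s * p.1 + t * q.1 = b.left - q.1 + (b.right - b.left - (p.1 - q.1)) / 2 ∧
      s * p.2 + t * q.2 = b.bottom + (b.top - b.bottom - (p.2 + q.2)) / 2 := by
    generalize b.left - q.1 + (b.right - b.left - (p.1 - q.1)) / 2 = x
    generalize b.bottom + (b.top - b.bottom - (p.2 + q.2)) / 2 = y
    have hd : p.1 * q.2 - p.2 * q.1 ≠ 0 := by nlinarith [mul_pos h1 hq, mul_pos hp (neg_pos.2 h2)]
    refine ⟨(x * q.2 - y * q.1) / (p.1 * q.2 - p.2 * q.1),
      (p.1 * y - p.2 * x) / (p.1 * q.2 - p.2 * q.1), ?_, ?_⟩ <;>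
      rw [div_mul_eq_mul_div, div_mul_eq_mul_div, ← add_div, div_eq_iff hd] <;> ring
  have hs := Int.le_ceil s
  have hs' := Int.ceil_lt_add_one s
  have ht := Int.le_ceil t
  have ht' := Int.ceil_lt_add_one t
  apply hb.notMem (h.coords_mem ⌈s⌉ ⌈t⌉) <;> simp only <;> nlinarith

end IsUpperBasis

/-- Adding a multiple of one basis vector to the other. -/
theorem closure_pair_add_nsmul {G : Type*} [AddCommGroup G] (p q : G) (j : ℕ) :
    AddSubgroup.closure {p, q + j • p} = AddSubgroup.closure {p, q} := by
  have hp : ∀ r : G, p ∈ AddSubgroup.closure {p, r} := fun r =>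
    AddSubgroup.subset_closure (by simp)
  have hq : ∀ r : G, r ∈ AddSubgroup.closure {p, r} := fun r =>
    AddSubgroup.subset_closure (by simp)
  apply le_antisymm <;> rw [AddSubgroup.closure_le, Set.pair_subset_iff]
  · exact ⟨hp _, add_mem (hq _) (nsmul_mem (hp _) j)⟩
  · refine ⟨hp _, ?_⟩
    have := sub_mem (hq (q + j • p)) (nsmul_mem (hp (q + j • p)) j)
    simpa using this

/-! ### The two-sided sequence of minimal vectors -/

/-- Positive solutions of the two-sided recurrences with coefficients `a`: the absolute values
of the coordinates of the minimal vectors of the lattice. -/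
structure IsLadder (a : ℤ → ℕ) (X Y : ℤ → ℝ) : Prop where
  fst_pos : ∀ i, 0 < X i
  snd_pos : ∀ i, 0 < Y i
  fst_rec : ∀ i, X (i - 1) = a i * X i + X (i + 1)
  snd_rec : ∀ i, Y (i + 1) = a i * Y i + Y (i - 1)

/-- The minimal vectors, on alternating sides of the vertical axis. -/
def minVec (X Y : ℤ → ℝ) (i : ℤ) : ℝ × ℝ := ((-1) ^ i * X i, Y i)

/-- Positivity of `X` to the right and of `Y` to the left comes from the continued fractions. In the
other directions the recurrences only add positive terms. -/
theorem exists_isLadder {Δ Δ' : ℝ} {a : ℤ → ℕ}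
    (hΔ : HasContFracExpansion Δ (fun n => a (n : ℤ)))
    (hΔ' : HasContFracExpansion (-Δ') (fun n => if n = 0 then 0 else a (-(n : ℤ)))) :
    ∃ X Y : ℤ → ℝ, IsLadder a X Y ∧ X (-1) = Δ ∧ X 0 = 1 ∧ Y (-1) = -Δ' ∧ Y 0 = 1 := by
  obtain ⟨X, hX1, hX0, hX⟩ := exists_recurrence (fun i => -(a i : ℝ)) Δ 1
  obtain ⟨Y, hY1, hY0, hY⟩ := exists_recurrence (fun i => (a i : ℝ)) (-Δ') 1
  have hXr : ∀ i, X (i - 1) = a i * X i + X (i + 1) := fun i => by rw [hX]; ring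
  have hYr : ∀ i, Y (i + 1) = a i * Y i + Y (i - 1) := fun i => by rw [hY]; ring
  have hXp : ∀ n : ℕ, 0 < X n := by
    intro n
    have := hΔ.remainder_pos (Z := fun n => X ((n : ℤ) - 1)) (by simp [hX0, hX1]) (by simp [hX0])
      (fun n => by
        have := hXr n
        simp only [Nat.cast_add, Nat.cast_one, Nat.cast_ofNat, add_sub_cancel_right]
        rw [show (n : ℤ) + 2 - 1 = n + 1 by ring]
        exact this) n
    simpa using this
  have hXn : ∀ n : ℕ, 0 < X (-n) ∧ 0 < X (-n + 1) := by
    intro n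
    induction n with
    | zero => exact ⟨by simp [hX0], by simpa using hXp 1⟩
    | succ n ih =>
      have h := hXr (-n)
      rw [show -(n : ℤ) - 1 = -((n + 1 : ℕ) : ℤ) by push_cast; ring] at h
      refine ⟨?_, ?_⟩
      · rw [h]
        have := ih.1.le
        have := ih.2
        positivity
      · rw [show -((n + 1 : ℕ) : ℤ) + 1 = -n by push_cast; ring]
        exact ih.1
  have hYn : ∀ n : ℕ, 0 < Y (-n) := by
    intro n
    -- The sequence Y_{-1}, Y_0, Y_{-1}, Y_{-2}, …: the leading partial quotient 0 makes Y_{-1}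
    -- appear twice.
    refine hΔ'.remainder_pos
      (Z := fun n => Nat.casesOn n (Y (-1)) (fun k : ℕ => Y (-(k : ℤ)))) ?_ ?_ ?_ n
    · simp [hY0, hY1]
    · simp [hY0]
    · rintro (_ | n)
      · simp
      · have := hYr (-((n : ℤ) + 1))
        simp only [Nat.add_eq_zero_iff, one_ne_zero, and_false, if_false, Nat.cast_add,
          Nat.cast_one]
        rw [show -((n : ℤ) + 1) + 1 = -n by ring] at this
        change Y (-(n : ℤ)) = _ * Y (-((n + 1 : ℕ) : ℤ)) + Y (-((n + 2 : ℕ) : ℤ))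
        rw [this]
        push_cast
        congr 2
  have hYp : ∀ n : ℕ, 0 < Y n ∧ 0 < Y ((n : ℤ) - 1) := by
    intro n
    induction n with
    | zero => exact ⟨by simp [hY0], by simpa using hYn 1⟩
    | succ n ih =>
      refine ⟨?_, by push_cast; simpa using ih.1⟩
      push_cast
      rw [hYr]
      have := ih.1.le
      have := ih.2
      positivity
  refine ⟨X, Y, ⟨fun i => ?_, fun i => ?_, hXr, hYr⟩, hX1, hX0, hY1, hY0⟩
  · obtain ⟨n, rfl | rfl⟩ := i.eq_nat_or_neg
    exacts [hXp n, (hXn n).1]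
  · obtain ⟨n, rfl | rfl⟩ := i.eq_nat_or_neg
    exacts [(hYp n).1, hYn n]

namespace IsLadder

variable {a : ℤ → ℕ} {X Y : ℤ → ℝ}

theorem minVec_add_one (h : IsLadder a X Y) (i : ℤ) :
    minVec X Y (i + 1) = minVec X Y (i - 1) + a i • minVec X Y i := by
  have e1 : (-1 : ℝ) ^ (i + 1) = -(-1) ^ i := by rw [zpow_add_one₀ (by norm_num)]; ring
  have e2 : (-1 : ℝ) ^ (i - 1) = -(-1) ^ i := by rw [zpow_sub_one₀ (by norm_num)]; ring
  ext
  · simp only [minVec, Prod.fst_add, Prod.smul_mk, nsmul_eq_mul, e1, e2, h.fst_rec i]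
    ring
  · simp only [minVec, Prod.snd_add, Prod.smul_mk, nsmul_eq_mul, h.snd_rec i]
    ring

/-- This is the absolute determinant of v_i, v_{i-1}; the alternating signs turn it into a sum of
positive terms, and the recurrence preserves it. -/
theorem det_eq (h : IsLadder a X Y) (i : ℤ) :
    X i * Y (i - 1) + X (i - 1) * Y i = X 0 * Y (-1) + X (-1) * Y 0 := by
  have hs : ∀ i, X (i + 1) * Y i + X i * Y (i + 1) = X i * Y (i - 1) + X (i - 1) * Y i := by
    intro i
    rw [h.fst_rec i, h.snd_rec i]
    ring
  induction i using Int.induction_on with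
  | zero => simp
  | succ n ih => rw [add_sub_cancel_right, hs, ih]
  | pred n ih =>
    have := hs (-n - 1)
    rw [sub_add_cancel] at this
    rw [← this, ih]

theorem closure_minVec (h : IsLadder a X Y) (i : ℤ) :
    AddSubgroup.closure {minVec X Y i, minVec X Y (i - 1)} =
      AddSubgroup.closure {minVec X Y 0, minVec X Y (-1)} := by
  have hs : ∀ i, AddSubgroup.closure {minVec X Y (i + 1), minVec X Y i} =
      AddSubgroup.closure {minVec X Y i, minVec X Y (i - 1)} := by
    intro i
    rw [h.minVec_add_one, Set.pair_comm, closure_pair_add_nsmul]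
  induction i using Int.induction_on with
  | zero => simp
  | succ n ih => rw [add_sub_cancel_right, hs, ih]
  | pred n ih =>
    have := hs (-n - 1)
    rw [sub_add_cancel] at this
    rw [← this, ih]

theorem fst_add_one_lt (h : IsLadder a X Y) (ha : ∀ i, 0 < a i) (i : ℤ) : X (i + 1) < X i := by
  have h1 : (1 : ℝ) ≤ a (i + 1) := by exact_mod_cast ha (i + 1)
  have h2 := h.fst_rec (i + 1)
  rw [add_sub_cancel_right] at h2
  nlinarith [h.fst_pos (i + 1), h.fst_pos (i + 1 + 1)]

theorem snd_sub_one_lt (h : IsLadder a X Y) (ha : ∀ i, 0 < a i) (i : ℤ) : Y (i - 1) < Y i := by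
  have h1 : (1 : ℝ) ≤ a (i - 1) := by exact_mod_cast ha (i - 1)
  have h2 := h.snd_rec (i - 1)
  rw [sub_add_cancel] at h2
  nlinarith [h.snd_pos (i - 1), h.snd_pos (i - 1 - 1)]

theorem remainder_pos (h : IsLadder a X Y) (i : ℤ) {j : ℕ} (hj : j ≤ a i) :
    0 < X (i - 1) - j * X i := by
  have h1 := h.fst_pos i
  have h2 := h.fst_pos (i + 1)
  have h3 : (j : ℝ) ≤ a i := by exact_mod_cast hj
  rw [h.fst_rec]
  nlinarith

theorem fst_intermediate (X Y : ℤ → ℝ) (i : ℤ) (j : ℕ) :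
    (minVec X Y (i - 1) + j • minVec X Y i).1 = -((-1) ^ i * (X (i - 1) - j * X i)) := by
  have e2 : (-1 : ℝ) ^ (i - 1) = -(-1) ^ i := by rw [zpow_sub_one₀ (by norm_num)]; ring
  simp only [minVec, Prod.fst_add, Prod.smul_mk, nsmul_eq_mul, e2]
  ring

theorem snd_intermediate (X Y : ℤ → ℝ) (i : ℤ) (j : ℕ) :
    (minVec X Y (i - 1) + j • minVec X Y i).2 = Y (i - 1) + j * Y i := by
  simp [minVec]

theorem isUpperBasis (h : IsLadder a X Y) (i : ℤ) {j : ℕ} (hj : j ≤ a i) :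
    IsUpperBasis (AddSubgroup.closure {minVec X Y 0, minVec X Y (-1)})
      (minVec X Y i) (minVec X Y (i - 1) + j • minVec X Y i) := by
  refine ⟨by rw [closure_pair_add_nsmul, h.closure_minVec], ?_, h.snd_pos i, ?_⟩
  · have h1 := h.fst_pos i
    have h2 := h.remainder_pos i hj
    have h3 : ((-1 : ℝ) ^ i) * (-1) ^ i = 1 := by
      rw [← mul_zpow]; norm_num
    rw [fst_intermediate, minVec]
    have : (-1 : ℝ) ^ i * X i * -((-1) ^ i * (X (i - 1) - j * X i)) =
        -(X i * (X (i - 1) - j * X i)) := by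
      linear_combination (-(X i * (X (i - 1) - j * X i))) * h3
    rw [this]
    have := mul_pos h1 h2
    linarith
  · rw [snd_intermediate]
    have h1 := (h.snd_pos i).le
    have h2 := h.snd_pos (i - 1)
    positivity

end IsLadder

/-- `B` lists the boxes spanned by consecutive minimal and intermediate vectors. -/
def IsLadderBoxes (a : ℤ → ℕ) (X Y : ℤ → ℝ) (B : ℤ → AxisBox) : Prop :=
  ∀ (i : ℤ) (j : ℕ), j ≤ a i →
    IsSpannedBy (B (partialSum a i + j)) (minVec X Y i) (minVec X Y (i - 1) + j • minVec X Y i)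

theorem IsLadder.exists_isLadderBoxes {a : ℤ → ℕ} {X Y : ℤ → ℝ} (h : IsLadder a X Y)
    (ha : ∀ i, 0 < a i) : ∃ B, IsLadderBoxes a X Y B := by
  have hm := partialSum_strictMono ha
  have key : ∀ n : ℤ, ∃ b, ∀ (i : ℤ) (j : ℕ), j ≤ a i → n = partialSum a i + j →
      IsSpannedBy b (minVec X Y i) (minVec X Y (i - 1) + j • minVec X Y i) := by
    intro n
    obtain ⟨k, l, hl, hn⟩ := exists_partialSum_add ha n
    obtain ⟨b, hb⟩ := (h.isUpperBasis k hl.le).exists_isSpannedBy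
    refine ⟨b, fun i j hj hij => ?_⟩
    have hk := partialSum_add_one a k
    have hi := partialSum_add_one a i
    have h1 : i < k + 1 := hm.lt_iff_lt.1 (by omega)
    have h2 : k ≤ i + 1 := hm.le_iff_le.1 (by omega)
    rcases (show i = k ∨ k = i + 1 by omega) with rfl | rfl
    -- An index has two descriptions only at a block boundary, as j = a_i in block i and as 0 in
    -- block i + 1. Both give the basis v_i, v_{i+1}, in swapped order.
    · obtain rfl : j = l := by omega
      exact hb
    · obtain rfl : l = 0 := by omega
      obtain rfl : j = a i := by omega
      rw [← h.minVec_add_one]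
      simpa using hb.symm
  choose B hB using key
  exact ⟨B, fun i j hj => hB _ i j hj rfl⟩

namespace IsLadderBoxes

variable {a : ℤ → ℕ} {X Y : ℤ → ℝ} {B : ℤ → AxisBox}

theorem height_eq (hB : IsLadderBoxes a X Y B) (i : ℤ) {j : ℕ} (hj : j ≤ a i) :
    (B (partialSum a i + j)).height = Y i + Y (i - 1) + j * Y i := by
  rw [(hB i j hj).height_eq, IsLadder.snd_intermediate, minVec]
  ring

theorem width_eq (h : IsLadder a X Y) (hB : IsLadderBoxes a X Y B) (i : ℤ) {j : ℕ}
    (hj : j ≤ a i) :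
    (B (partialSum a i + j)).right - (B (partialSum a i + j)).left =
      X i + X (i - 1) - j * X i := by
  have h1 := h.fst_pos i
  have h2 := h.remainder_pos i hj
  rw [(hB i j hj).width_eq, IsLadder.fst_intermediate, minVec]
  rw [show (-1 : ℝ) ^ i * X i - -((-1) ^ i * (X (i - 1) - j * X i)) =
    (-1) ^ i * (X i + X (i - 1) - j * X i) by ring, abs_mul, abs_zpow, abs_neg, abs_one, one_zpow,
    one_mul, abs_of_pos (by linarith)]

theorem height_strictMono (ha : ∀ i, 0 < a i) (h : IsLadder a X Y)
    (hB : IsLadderBoxes a X Y B) : StrictMono fun n => (B n).height := by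
  refine strictMono_int_of_lt_succ fun n => ?_
  obtain ⟨i, j, hj, rfl⟩ := exists_partialSum_add ha n
  have := hB.height_eq i (j := j + 1) hj
  push_cast at this
  rw [← add_assoc] at this
  rw [this, hB.height_eq i hj.le]
  linarith [h.snd_pos i]

/-- Every positive number lies between the heights of two consecutive boxes. -/
theorem exists_height_lt_le (ha : ∀ i, 0 < a i) (h : IsLadder a X Y)
    (hB : IsLadderBoxes a X Y B) {t : ℝ} (ht : 0 < t) :
    ∃ n, (B n).height < t ∧ t ≤ (B (n + 1)).height := by
  have hstep : ∀ i, Y i + Y (i - 1) ≤ Y (i + 1) := by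
    intro i
    have h1 := h.snd_pos i
    have h2 : (1 : ℝ) ≤ a i := by exact_mod_cast ha i
    rw [h.snd_rec]
    nlinarith
  have hdouble : ∀ i, 2 * Y (i - 1) ≤ Y (i + 1) := by
    intro i
    have h1 := hstep i
    have h2 := hstep (i - 1)
    have h3 := h.snd_pos (i - 1 - 1)
    rw [sub_add_cancel] at h2
    linarith
  have hup : ∀ k : ℕ, 2 ^ k * Y 0 ≤ Y (2 * k) := by
    intro k
    induction k with
    | zero => simp
    | succ k ih =>
      have := hdouble (2 * k + 1)
      rw [add_sub_cancel_right, show (2 * (k : ℤ) + 1 + 1) = 2 * ((k + 1 : ℕ) : ℤ) by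
        push_cast; ring] at this
      rw [pow_succ]
      linarith
  have hdn : ∀ k : ℕ, 2 ^ k * Y (-(2 * k)) ≤ Y 0 := by
    intro k
    induction k with
    | zero => simp
    | succ k ih =>
      have := hdouble (-(2 * k) - 1)
      rw [sub_add_cancel, show (-(2 * (k : ℤ)) - 1 - 1) = -(2 * ((k + 1 : ℕ) : ℤ)) by
        push_cast; ring] at this
      refine le_trans ?_ ih
      rw [pow_succ, mul_assoc]
      exact mul_le_mul_of_nonneg_left this (by positivity)
  have hH : ∀ i, (B (partialSum a i)).height = Y i + Y (i - 1) := by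
    intro i
    simpa using hB.height_eq i (Nat.zero_le (a i))
  have hY0 := h.snd_pos 0
  refine exists_int_lt_le_succ (hB.height_strictMono ha h) ?_ ?_
  · obtain ⟨k, hk⟩ := pow_unbounded_of_one_lt (2 * Y 0 / t) (one_lt_two (α := ℝ))
    refine ⟨partialSum a (-(2 * k)), ?_⟩
    change (B _).height < t
    rw [hH]
    have h1 := hstep (-(2 * k) - 1)
    rw [sub_add_cancel] at h1
    have h2 := h.snd_pos (-(2 * k) - 1 - 1)
    rw [div_lt_iff₀ ht] at hk
    have h3 : (0 : ℝ) < 2 ^ k := by positivity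
    refine lt_of_mul_lt_mul_left ?_ h3.le
    nlinarith [hdn k]
  · obtain ⟨k, hk⟩ := pow_unbounded_of_one_lt (t / Y 0) (one_lt_two (α := ℝ))
    refine ⟨partialSum a (2 * k), ?_⟩
    change t ≤ (B _).height
    rw [hH]
    rw [div_lt_iff₀ hY0] at hk
    linarith [hup k, h.snd_pos (2 * k - 1)]

theorem range_eq (ha : ∀ i, 0 < a i) (h : IsLadder a X Y) (hB : IsLadderBoxes a X Y B) :
    Set.range B = originBoxes (AddSubgroup.closure {minVec X Y 0, minVec X Y (-1)}) := by
  apply Set.Subset.antisymm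
  · rintro _ ⟨n, rfl⟩
    obtain ⟨i, j, hj, rfl⟩ := exists_partialSum_add ha n
    exact (h.isUpperBasis i hj.le).mem_originBoxes (hB i j hj.le)
  · intro c hc
    obtain ⟨n, h1, h2⟩ := hB.exists_height_lt_le ha h (sub_pos.2 c.bottom_lt_top)
    obtain ⟨i, j, hj, rfl⟩ := exists_partialSum_add ha n
    -- The box n + 1 is the candidate: the higher of its two spanning vectors is exactly as high as
    -- box n, hence lower than `c`.
    have hb := hB i (j + 1) hj
    push_cast at hb
    rw [← add_assoc] at hb
    rw [hb.height_eq] at h2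
    rw [hB.height_eq i hj.le] at h1
    have hY := h.snd_pos i
    have hY' := h.snd_pos (i - 1)
    refine ⟨_, ((h.isUpperBasis i hj).eq_of_mem_originBoxes hb hc ?_ ?_ h2).symm⟩
    · refine lt_of_le_of_lt ?_ h1
      rw [minVec]
      have : 0 ≤ (j : ℝ) * Y i := by positivity
      linarith
    · refine lt_of_le_of_lt ?_ h1
      rw [IsLadder.snd_intermediate]
      push_cast
      linarith

/-- With bounded coefficients the areas of empty boxes are bounded. -/
theorem area_le (ha : ∀ i, 0 < a i) (h : IsLadder a X Y) (hB : IsLadderBoxes a X Y B) {M : ℕ}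
    (hM : ∀ i, a i ≤ M) {b : AxisBox}
    (hb : IsEmptyBox (AddSubgroup.closure {minVec X Y 0, minVec X Y (-1)}) b) :
    (b.right - b.left) * b.height ≤ 4 * (M + 2) * (X 0 * Y (-1) + X (-1) * Y 0) := by
  obtain ⟨n, h1, h2⟩ := hB.exists_height_lt_le ha h (sub_pos.2 b.bottom_lt_top)
  obtain ⟨i, j, hj, rfl⟩ := exists_partialSum_add ha n
  -- Box n limits the width of `b`, and box n + 1 its height.
  have hw := (h.isUpperBasis i hj.le).width_le_of_isEmptyBox hb
    (by rw [← (hB i j hj.le).height_eq]; exact h1)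
  rw [← (hB i j hj.le).width_eq, hB.width_eq h i hj.le] at hw
  have e := hB.height_eq i (j := j + 1) hj
  push_cast at e
  rw [← add_assoc] at e
  rw [e] at h2
  change b.height ≤ _ at h2
  have hX := h.fst_pos i
  have hX' := h.fst_pos (i - 1)
  have hY := h.snd_pos i
  have hY' := h.snd_pos (i - 1)
  have hd := h.det_eq i
  have hXle : X i ≤ X (i - 1) := by simpa using (h.fst_add_one_lt ha (i - 1)).le
  have hYle := (h.snd_sub_one_lt ha i).le
  have hjM : (j : ℝ) + 1 ≤ M := by exact_mod_cast (show j + 1 ≤ a i from hj).trans (hM i)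
  have hjX : 0 ≤ (j : ℝ) * X i := by positivity
  have hwb : b.right - b.left ≤ 2 * X (i - 1) := by linarith
  have hhb : b.height ≤ (M + 2) * Y i := by nlinarith
  have hpos : 0 ≤ b.height := sub_nonneg.2 b.bottom_lt_top.le
  calc (b.right - b.left) * b.height ≤ 2 * X (i - 1) * ((M + 2) * Y i) := by gcongr
    _ = 2 * (M + 2) * (X (i - 1) * Y i) := by ring
    _ ≤ 4 * (M + 2) * (X 0 * Y (-1) + X (-1) * Y 0) := by
      rw [← hd]
      have h5 : 0 < X i * Y (i - 1) := mul_pos hX hY'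
      have h6 : 0 < X (i - 1) * Y i := mul_pos hX' hY
      gcongr
      · norm_num
      · linarith

end IsLadderBoxes

/-! ### The area function -/

/-- The numerator over 4 is the largest product of two integers with sum a + 2. -/
theorem boundL_eq {a : ℕ} (ha : 0 < a) :
    boundL a = ((a + 2 : ℝ) ^ 2 - (a % 2 : ℕ)) / (4 * a) := by
  have : (a : ℝ) ≠ 0 := by positivity
  rw [boundL]
  field_simp
  ring

theorem boundL_add_two_lt {a : ℕ} (ha : 0 < a) : boundL (a + 2) < boundL a + 1 / 2 := by
  have h1 : ((a % 2 : ℕ) : ℝ) ≤ 1 := by exact_mod_cast Nat.lt_succ_iff.1 (Nat.mod_lt a two_pos)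
  have hp : (0 : ℝ) < a := by exact_mod_cast ha
  have h2 : (1 : ℝ) / ((a + 2 : ℕ) : ℝ) < 1 / a :=
    one_div_lt_one_div_of_lt hp (by push_cast; linarith)
  rw [boundL, boundL, Nat.add_mod_right]
  have e : ∀ r x : ℝ, r / (4 * x) = r / 4 * (1 / x) := fun r x => by
    rw [mul_one_div, div_div]
  rw [e, e]
  push_cast at h2 ⊢
  nlinarith

/-- The area of the box spanned by a basis with coordinate ratios `x` and `y`, relative to the
determinant. -/
def normalizedArea (x y : ℝ) : ℝ := (1 + x) * (1 + y) / (x + y)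

/-- After cross-multiplication the difference is (x' - x)(y² - 1). -/
theorem normalizedArea_lt_left {x x' y : ℝ} (hx : 0 < x) (hxx : x < x') (hy : 1 < y) :
    normalizedArea x y < normalizedArea x' y := by
  rw [normalizedArea, normalizedArea, div_lt_div_iff₀ (by linarith) (by linarith)]
  have := mul_pos (mul_pos (sub_pos.2 hxx) (sub_pos.2 hy)) (by linarith : (0 : ℝ) < 1 + y)
  nlinarith

theorem normalizedArea_lt {x x' y y' : ℝ} (hx : 1 ≤ x) (hxx : x < x') (hy : 1 ≤ y)
    (hyy : y < y') : normalizedArea x y < normalizedArea x' y' := by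
  have h1 : normalizedArea x y ≤ normalizedArea x y' := by
    rw [normalizedArea, normalizedArea, div_le_div_iff₀ (by linarith) (by linarith)]
    have := mul_nonneg (mul_nonneg (sub_nonneg.2 hyy.le) (sub_nonneg.2 hx))
      (by linarith : (0 : ℝ) ≤ 1 + x)
    nlinarith
  exact h1.trans_lt (normalizedArea_lt_left (by linarith) hxx (by linarith))

/-- At j = ⌊a/2⌋ the value for θ = δ = 0 is exactly L(a), and a > 1 makes both arguments at least 1.
-/
theorem boundL_lt_normalizedArea {a : ℕ} (ha : 1 < a) {θ δ : ℝ} (hθ : 0 < θ) (hδ : 0 < δ) :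
    boundL a < normalizedArea (a + θ - (a / 2 : ℕ)) (δ + (a / 2 : ℕ)) := by
  have h1 : (1 : ℝ) ≤ (a / 2 : ℕ) := by exact_mod_cast (by omega : 1 ≤ a / 2)
  have h2 : (1 : ℝ) ≤ a - (a / 2 : ℕ) := by
    have : ((a / 2 : ℕ) : ℝ) + 1 ≤ a := by exact_mod_cast (by omega : a / 2 + 1 ≤ a)
    linarith
  refine lt_of_eq_of_lt ?_ (normalizedArea_lt h2 (x' := a + θ - (a / 2 : ℕ)) (by linarith) h1
    (y' := δ + (a / 2 : ℕ)) (by linarith))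
  have hp : (a : ℝ) ≠ 0 := by positivity
  have h3 : (a : ℝ) = 2 * (a / 2 : ℕ) + (a % 2 : ℕ) := by
    exact_mod_cast (Nat.div_add_mod a 2).symm
  have h4 : ((a % 2 : ℕ) : ℝ) * (a % 2 : ℕ) = (a % 2 : ℕ) := by
    rcases Nat.mod_two_eq_zero_or_one a with h | h <;> simp [h]
  rw [boundL_eq (by omega), normalizedArea, sub_add_cancel, div_eq_div_iff (by positivity) hp]
  generalize ((a / 2 : ℕ) : ℝ) = k at *
  generalize ((a % 2 : ℕ) : ℝ) = r at *
  rw [h3]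
  linear_combination (2 * k + r) * h4

theorem normalizedArea_lt_boundL {a j : ℕ} (ha : 1 < a) (hj : j < a) {θ δ : ℝ} (hθ : 0 < θ)
    (hθ1 : θ < 1) (hδ : 0 < δ) (hδ1 : δ < 1) :
    normalizedArea (a + θ - j) (δ + j) < boundL (a + 2) := by
  have hr : (((a % 2 : ℕ)) : ℝ) ≤ ((a : ℝ) - 2 * j) ^ 2 := by
    have : ((a % 2 : ℕ) : ℤ) ≤ ((a : ℤ) - 2 * j) ^ 2 := by
      rcases Nat.mod_two_eq_zero_or_one a with h | h
      · rw [h]; positivity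
      · rw [h]
        have : (a : ℤ) - 2 * j ≠ 0 := by omega
        have : 0 < ((a : ℤ) - 2 * j) ^ 2 := by positivity
        push_cast; omega
    have h' := (Int.cast_le (R := ℝ)).2 this
    push_cast at h' ⊢
    exact h'
  have ha' : (2 : ℝ) ≤ a := by exact_mod_cast ha
  rw [boundL_eq (by omega), Nat.add_mod_right]
  -- For j = 0 the second argument δ is below 1 and monotonicity fails. There the area is below 2,
  -- because (1+x)(1+δ) - 2(x+δ) = (1-x)(1-δ) < 0.
  rcases Nat.eq_zero_or_pos j with rfl | hj0
  · have h1 : normalizedArea (a + θ - (0 : ℕ)) (δ + (0 : ℕ)) < 2 := by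
      rw [normalizedArea, div_lt_iff₀ (by push_cast; linarith)]
      push_cast
      nlinarith
    refine h1.trans_le ?_
    have h2 : ((a % 2 : ℕ) : ℝ) ≤ 1 := by
      exact_mod_cast Nat.lt_succ_iff.1 (Nat.mod_lt a two_pos)
    rw [le_div_iff₀ (by positivity)]
    push_cast
    nlinarith
  · have hj1 : (1 : ℝ) ≤ j := by exact_mod_cast hj0
    have hja : (j : ℝ) + 1 ≤ a := by exact_mod_cast hj
    refine (normalizedArea_lt (x := a + θ - j) (x' := a + 1 - j) (y := δ + j) (y' := j + 1)
      (by linarith) (by linarith) (by linarith) (by linarith)).trans_le ?_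
    rw [normalizedArea, show (a : ℝ) + 1 - j + (j + 1) = a + 2 by ring,
      div_le_div_iff₀ (by linarith) (by positivity)]
    push_cast
    have h5 : 0 ≤ ((a : ℝ) + 2) * (((a : ℝ) - 2 * j) ^ 2 - (a % 2 : ℕ)) :=
      mul_nonneg (by linarith) (by linarith)
    nlinarith

theorem div_four_le_boundL {a : ℕ} (ha : 0 < a) : (a : ℝ) / 4 ≤ boundL a := by
  have h2 : ((a % 2 : ℕ) : ℝ) ≤ 1 := by
    exact_mod_cast Nat.lt_succ_iff.1 (Nat.mod_lt a two_pos)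
  have hp : (0 : ℝ) < a := by exact_mod_cast ha
  rw [boundL_eq ha, div_le_div_iff₀ (by norm_num) (by positivity)]
  nlinarith

/-! ### The main theorem -/

/-- Divide width by X_i, height by Y_i and the determinant by X_i Y_i: they become 1 + x, 1 + y and
x + y. -/
theorem IsLadderBoxes.area_div_det {a : ℤ → ℕ} {X Y : ℤ → ℝ} {B : ℤ → AxisBox}
    (h : IsLadder a X Y) (hB : IsLadderBoxes a X Y B) (i : ℤ) {j : ℕ} (hj : j ≤ a i) :
    (B (partialSum a i + j)).area / (X 0 * Y (-1) + X (-1) * Y 0) =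
      normalizedArea (a i + X (i + 1) / X i - j) (Y (i - 1) / Y i + j) := by
  have hX := h.fst_pos i
  have hY := h.snd_pos i
  have hd : 0 < X i * Y (i - 1) + X (i - 1) * Y i :=
    add_pos (mul_pos hX (h.snd_pos _)) (mul_pos (h.fst_pos _) hY)
  rw [AxisBox.area_eq, hB.width_eq h i hj, hB.height_eq i hj, ← h.det_eq i, normalizedArea]
  rw [h.fst_rec i] at hd ⊢
  have e : (a i : ℝ) + X (i + 1) / X i - j + (Y (i - 1) / Y i + j) =
      (X i * Y (i - 1) + (a i * X i + X (i + 1)) * Y i) / (X i * Y i) := by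
    field_simp
    ring
  rw [e, div_div_eq_mul_div]
  congr 1
  field_simp
  ring

theorem exists_isGreatest_normalizedArea {a : ℕ} (ha : 1 < a) {θ δ : ℝ} (hθ : 0 < θ)
    (hθ1 : θ < 1) (hδ : 0 < δ) (hδ1 : δ < 1) :
    ∃ M : ℝ, IsGreatest ((fun j : ℕ => normalizedArea (a + θ - j) (δ + j)) '' {j | j < a}) M ∧
      boundL a < M ∧ M < boundL (a + 2) := by
  obtain ⟨k, hk, hmax⟩ := Finset.exists_max_image (Finset.range a)
    (fun j : ℕ => normalizedArea (a + θ - j) (δ + j)) ⟨0, by simp; omega⟩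
  rw [Finset.mem_range] at hk
  refine ⟨_, ⟨⟨k, hk, rfl⟩, ?_⟩, ?_, normalizedArea_lt_boundL ha hk hθ hθ1 hδ hδ1⟩
  · rintro _ ⟨j, hj, rfl⟩
    exact hmax j (Finset.mem_range.2 hj)
  · exact (boundL_lt_normalizedArea ha hθ hδ).trans_le
      (hmax (a / 2) (Finset.mem_range.2 (by omega)))

/-- The reindexing between two enumerations is an increasing bijection of ℤ fixing 0, hence the
identity. -/
theorem IsBoxEnumeration.unique {Δ Δ' : ℝ} {B C : ℤ → AxisBox} (hB : IsBoxEnumeration Δ Δ' B)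
    (hC : IsBoxEnumeration Δ Δ' C) : B = C := by
  have hCinj : Function.Injective C := fun m n hmn =>
    hC.strictMono_height.injective (by simp only [hmn])
  have h1 : ∀ n, ∃ m, C m = B n := fun n => by
    have : B n ∈ Set.range C := by
      rw [hC.range_eq, ← hB.range_eq]
      exact ⟨n, rfl⟩
    exact this
  choose φ hφ using h1
  have hmono : StrictMono φ := fun m n hmn => by
    have := hB.strictMono_height hmn
    simp only [← hφ] at this
    exact hC.strictMono_height.lt_iff_lt.1 this
  have hsurj : Function.Surjective φ := fun m => by
    have : C m ∈ Set.range B := by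
      rw [hB.range_eq, ← hC.range_eq]
      exact ⟨m, rfl⟩
    obtain ⟨n, hn⟩ := this
    exact ⟨n, hCinj (by rw [hφ, hn])⟩
  have h0 : φ 0 = 0 := hCinj (by
    rw [hφ]
    exact AxisBox.toSet_injective (by rw [hB.toSet_zero, hC.toSet_zero]))
  funext n
  rw [← hφ, hmono.eq_id_of_surjective hsurj h0]

end

theorem mainTheorem1 (Δ Δ' : ℝ) (a : ℤ → ℕ)
    (hirr : IsIrrationalLattice (latticeOf (normalizedMatrix Δ Δ')))
    (ha : ∀ i, 0 < a i)
    (hΔ : HasContFracExpansion Δ (fun n => a (n : ℤ)))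
    (hΔ' : HasContFracExpansion (-Δ') (fun n => if n = 0 then 0 else a (-(n : ℤ)))) :
    (∃! B : ℤ → AxisBox, IsBoxEnumeration Δ Δ' B) ∧
    (∀ B : ℤ → AxisBox, IsBoxEnumeration Δ Δ' B → ∀ i : ℤ, 1 < a i →
      ∃ M : ℝ,
        IsGreatest
          ((fun j : ℕ =>
            (B (partialSum a i + (j : ℤ))).area / |(normalizedMatrix Δ Δ').det|) ''
              {j | j < a i}) M ∧
        boundL (a i) < M ∧ M < boundL (a i + 2) ∧ boundL (a i + 2) < boundL (a i) + 1 / 2) ∧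
    (latticeDispersion (latticeOf (normalizedMatrix Δ Δ')) < ⊤ ↔ BddAbove (Set.range a)) := by
  obtain ⟨X, Y, h, hX1, hX0, hY1, hY0⟩ := exists_isLadder hΔ hΔ'
  obtain ⟨B, hB⟩ := h.exists_isLadderBoxes ha
  have hΓ : latticeOf (normalizedMatrix Δ Δ') =
      AddSubgroup.closure {minVec X Y 0, minVec X Y (-1)} := by
    simp [latticeOf, normalizedMatrix, minVec, hX1, hX0, hY1, hY0]
  have hΔpos : 0 < Δ := hX1 ▸ h.fst_pos (-1)
  have hΔ'neg : Δ' < 0 := by have := h.snd_pos (-1); linarith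
  have hdet : |(normalizedMatrix Δ Δ').det| = X 0 * Y (-1) + X (-1) * Y 0 := by
    rw [normalizedMatrix, Matrix.det_fin_two_of, hX1, hX0, hY1, hY0, abs_of_pos (by linarith)]
    ring
  have hdpos : 0 < X 0 * Y (-1) + X (-1) * Y 0 :=
    add_pos (mul_pos (h.fst_pos _) (h.snd_pos _)) (mul_pos (h.fst_pos _) (h.snd_pos _))
  have hBe : IsBoxEnumeration Δ Δ' B := by
    refine ⟨hB.height_strictMono ha h, by rw [hΓ, hB.range_eq ha h], ?_⟩
    obtain ⟨h1, h2, h3, h4⟩ := hB 0 0 (Nat.zero_le _)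
    rw [partialSum_zero] at h1 h2 h3 h4
    have e : minVec X Y (0 - 1) + 0 • minVec X Y 0 = (-Δ, -Δ') := by
      simp [minVec, hX1, hY1]
    have e' : minVec X Y 0 = (1, 1) := by simp [minVec, hX0, hY0]
    rw [e, e'] at h1 h2 h4
    simp only [Nat.cast_zero, add_zero] at h1 h2 h3 h4
    rw [AxisBox.toSet, h1, h2, h3, h4, min_eq_right (by linarith), max_eq_left (by linarith),
      sub_eq_add_neg]
  have hmax : ∀ i : ℤ, 1 < a i → ∃ M : ℝ,
      IsGreatest ((fun j : ℕ =>
        (B (partialSum a i + (j : ℤ))).area / |(normalizedMatrix Δ Δ').det|) ''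
          {j | j < a i}) M ∧ boundL (a i) < M ∧ M < boundL (a i + 2) := by
    intro i hi
    have hX := h.fst_pos i
    have hY := h.snd_pos i
    obtain ⟨M, hM, hlt⟩ := exists_isGreatest_normalizedArea hi
      (div_pos (h.fst_pos (i + 1)) hX) ((div_lt_one hX).2 (h.fst_add_one_lt ha i))
      (div_pos (h.snd_pos (i - 1)) hY) ((div_lt_one hY).2 (h.snd_sub_one_lt ha i))
    refine ⟨M, ?_, hlt⟩
    convert hM using 1
    refine Set.image_congr fun j hj => ?_
    rw [hdet]
    exact hB.area_div_det h i (le_of_lt hj)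
  refine ⟨⟨B, hBe, fun C hC => hC.unique hBe⟩, ?_, ?_, ?_⟩
  · intro C hC i hi
    obtain rfl := hC.unique hBe
    obtain ⟨M, hM, h1, h2⟩ := hmax i hi
    exact ⟨M, hM, h1, h2, boundL_add_two_lt (ha i)⟩
  · intro hfin
    set d := X 0 * Y (-1) + X (-1) * Y 0
    set S := latticeDispersion (latticeOf (normalizedMatrix Δ Δ'))
    -- From a_i/4 ≤ L(a_i) < area/d ≤ S/d when a_i > 1; the extra 1 covers a_i = 1.
    refine ⟨⌈4 * (S.toReal / d)⌉₊ + 1, ?_⟩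
    rintro _ ⟨i, rfl⟩
    rcases le_or_gt (a i) 1 with hi | hi
    · omega
    · obtain ⟨M, ⟨⟨j, hj, rfl⟩, -⟩, h1, -⟩ := hmax i hi
      have h2 : (B (partialSum a i + j)).area ≤ S.toReal := by
        refine ENNReal.toReal_mono hfin.ne ?_
        refine le_iSup₂_of_le (B (partialSum a i + j)) ?_ le_rfl
        rw [hΓ]
        exact (h.isUpperBasis i (le_of_lt hj)).isEmptyBox (hB i j (le_of_lt hj))
      have h3 := div_four_le_boundL (ha i)
      simp only [hdet] at h1
      have h4 : (B (partialSum a i + j)).area / d ≤ S.toReal / d := by gcongr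
      have h5 : (a i : ℝ) ≤ ⌈4 * (S.toReal / d)⌉₊ :=
        le_trans (by linarith) (Nat.le_ceil _)
      have h6 : a i ≤ ⌈4 * (S.toReal / d)⌉₊ := by exact_mod_cast h5
      omega
  · rintro ⟨M, hM⟩
    refine lt_of_le_of_lt (iSup₂_le fun b hb => ?_) (ENNReal.ofReal_lt_top
      (r := 4 * (M + 2) * (X 0 * Y (-1) + X (-1) * Y 0)))
    rw [hΓ] at hb
    rw [AxisBox.volume_toSet]
    exact ENNReal.ofReal_le_ofReal (hB.area_le ha h (fun i => hM ⟨i, rfl⟩) hb)
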